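/- Let $n$ be an even positive integer and $p$ an odd prime with $\gcd(n,p)=1$. Let $R$ be a chain ring with residue field of cardinality $p$; that is, $R$ is either a finite chain ring (a finite commutative ring with $1\ne 0$ whose ideals are linearly ordered by inclusion), or a chain ring of infinite index (a complete discrete valuation ring, in particular the ring $K[[\gamma]]$ of formal power series over the field $K$ with $p$ elements). Suppose that one of the following holds: (i) $n=2n'$ with $n'$ odd, $p\equiv 1 \pmod 4$ and $n\mid p+1$; (ii) $n=2^a n'$ with $n'$ odd, $p\equiv 1 \pmod{2^{a+1}n'}$ and $n\mid p-1$. Then there is a linear code $C\subseteq R^n$ which is negacyclic, MDS and self-dual. These codes form infinite families: for every $n=2n'$ with $n'$ odd there are infinitely many odd primes $p$ with $\gcd(n,p)=1$ that satisfy (i), and for every even $n>0$ there are infinitely many odd primes $p$ with $\gcd(n,p)=1$ that satisfy (ii). Here $C$ is negacyclic if $(-c_{n-1},c_0,\dots,c_{n-2})\in C$ for all $(c_0,\dots,c_{n-1})\in C$; it is self-dual if $C=C^\perp=\{v\in R^n : \sum_i v_iw_i=0 \text{ for all } w\in C\}$. Let $d$ be the minimum Hamming weight of a nonzero codeword of $C$.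 For $R$ finite, $C$ is MDS if $d=n-\log_{|R|}|C|+1$; for $R$ infinite, $C$ is MDS if for some $k$ it has, up to a permutation of coordinates, a generator matrix $(I_k\mid A)$, and $d=n-k+1$. -/

import Mathlib

/-- A finite chain ring: a finite nonzero commutative ring whose ideals are linearly ordered by
inclusion. -/
def IsFiniteChainRing (R : Type*) [CommRing R] : Prop :=
  Finite R ∧ Nontrivial R ∧ ∀ I J : Ideal R, I ≤ J ∨ J ≤ I

/-- A chain ring of infinite index: a discrete valuation ring that is complete for the topology of
its maximal ideal `⟨γ⟩`, so that each element is a unique series `∑ a_l γ ^ l` whose digits `a_l`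
represent the residue field `K`.  The ring `K⟦γ⟧` of formal power series is the
equal-characteristic example, see `isInfiniteChainRing_powerSeries`. -/
def IsInfiniteChainRing (R : Type*) [CommRing R] : Prop :=
  ∃ _ : IsDomain R, ∃ _ : IsDiscreteValuationRing R,
    IsAdicComplete (IsLocalRing.maximalIdeal R) R

theorem isInfiniteChainRing_powerSeries (K : Type*) [Field K] :
    IsInfiniteChainRing (PowerSeries K) := by
  refine ⟨inferInstance, inferInstance, ?_⟩
  rw [PowerSeries.maximalIdeal_eq_span_X]
  infer_instance

/-- A chain ring `R_i` with `i ≤ ∞`. -/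
def IsChainRing (R : Type*) [CommRing R] : Prop :=
  IsFiniteChainRing R ∨ IsInfiniteChainRing R

section Codes

variable {R : Type*} [CommRing R] {n : ℕ}

/-- The vector `(l * c_{n-1}, c_0, …, c_{n-2})`. -/
def constacyclicShift (l : R) (c : Fin n → R) : Fin n → R := fun i =>
  if (i : ℕ) = 0 then l * c ⟨n - 1, by have := i.2; omega⟩
  else c ⟨(i : ℕ) - 1, by have := i.2; omega⟩

/-- A linear code of length `n` is `l`-constacyclic if it is closed under `constacyclicShift l`. -/
def IsConstacyclic (l : R) (C : Submodule R (Fin n → R)) : Prop :=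
  ∀ c ∈ C, constacyclicShift l c ∈ C

/-- A negacyclic code is a `(-1)`-constacyclic code. -/
def IsNegacyclic (C : Submodule R (Fin n → R)) : Prop := IsConstacyclic (-1) C

/-- The dual code with respect to the standard inner product `v ⬝ᵥ w = ∑ i, v i * w i`. -/
def dualCode (C : Submodule R (Fin n → R)) : Submodule R (Fin n → R) where
  carrier := {v | ∀ w ∈ C, v ⬝ᵥ w = 0}
  add_mem' := by
    intro a b ha hb w hw
    rw [add_dotProduct, ha w hw, hb w hw, add_zero]
  zero_mem' := fun w _ => zero_dotProduct w
  smul_mem' := by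
    intro r a ha w hw
    rw [smul_dotProduct, ha w hw, smul_zero]

/-- A code is self-dual if it equals its dual code. -/
def IsSelfDual (C : Submodule R (Fin n → R)) : Prop := C = dualCode C

open Classical in
/-- The minimum Hamming weight of a nonzero codeword. -/
noncomputable def minDist (C : Submodule R (Fin n → R)) : ℕ :=
  sInf {w : ℕ | ∃ c ∈ C, c ≠ 0 ∧ hammingNorm c = w}

/-- The code attains the Singleton bound `d ≤ n - log_{|R|} |C| + 1`.  It is only meaningful over a
finite ring. -/
def MeetsSingletonBound (C : Submodule R (Fin n → R)) : Prop :=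
  (minDist C : ℝ) = (n : ℝ) - Real.logb (Nat.card R : ℝ) (Nat.card C : ℝ) + 1

/-- The code has type `1 ^ k`: after a permutation of the coordinates it is the row space of a
matrix `(I_k | A)`. -/
def HasTypeOne (C : Submodule R (Fin n → R)) (k : ℕ) : Prop :=
  ∃ (σ : Fin k ⊕ Fin (n - k) ≃ Fin n) (A : Matrix (Fin k) (Fin (n - k)) R),
    C = Submodule.span R (Set.range fun i : Fin k =>
      (fun j : Fin n => Matrix.fromCols (1 : Matrix (Fin k) (Fin k) R) A i (σ.symm j)))

/-- MDS codes.  Over a finite ring these are the codes that attain the Singleton bound.  Over an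
infinite chain ring these are the codes of type `1 ^ k`, for some `k`, that attain the bound
`d ≤ n - k + 1` for codes of rank `k`. -/
def IsMDS (C : Submodule R (Fin n → R)) : Prop :=
  (Finite R → MeetsSingletonBound C) ∧
  (Infinite R → ∃ k : ℕ, HasTypeOne C k ∧ minDist C + k = n + 1)

end Codes

/-- The first family of parameters: `n = 2 n'` with `n'` odd, `p ≡ 1 mod 4` and `n ∣ p + 1`. -/
def ParamsOne (n p : ℕ) : Prop :=
  ∃ n' : ℕ, Odd n' ∧ n = 2 * n' ∧ p ≡ 1 [MOD 4] ∧ n ∣ p + 1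

/-- The second family of parameters: `n = 2 ^ a n'` with `n'` odd, `p ≡ 1 mod 2 ^ (a + 1) n'` and
`n ∣ p - 1`. -/
def ParamsTwo (n p : ℕ) : Prop :=
  ∃ a n' : ℕ, Odd n' ∧ n = 2 ^ a * n' ∧ p ≡ 1 [MOD 2 ^ (a + 1) * n'] ∧ n ∣ p - 1

/-! Put n = 2k and N = a^2 - d. The powers (a + √d)^t = x_t + y_t √d, for 0 ≤ t < n, give points
(x_t : y_t) of the projective line: an orbit of a torus element of projective order n. The code
evaluates the binary forms of degree k - 1 on this orbit and scales coordinate t by l^t, as in a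
Reed–Solomon code. Its maximal minors are projective Vandermonde determinants, which are units
because the points are pairwise distinct even in the residue field; hence it is MDS
(`hasUnitMinors`). A step along the orbit is a linear substitution in the forms, so the code is
constacyclic, and l^2 N^(k-1) = -1 makes the constant -1 (`isNegacyclic`). After adjoining √d, inner
products of rows become combinations of geometric sums that vanish (`sum_eq_zero`), so the code is
self-dual.

It remains to find (a, d, l). Over the field with p elements the torus is split if 2n ∣ p - 1, and
nonsplit, inside the field with p^2 elements, if n ∣ p + 1. Since p does not divide n, Hensel's
lemma lifts the datum to R (`exists_lift`). Dirichlet's theorem supplies the primes. -/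

open Matrix

/-! ### Codes whose maximal minors are units: MDS and self-duality criteria. -/

section GeneratorMatrix

variable {R : Type*} [CommRing R] {n k : ℕ}

/-- The row space of a generator matrix. -/
def rowCode (G : Matrix (Fin k) (Fin n) R) : Submodule R (Fin n → R) :=
  Submodule.span R (Set.range fun i => G i)

/-- Every `k` distinct columns of the matrix are the columns of an invertible matrix. -/
def HasUnitMinors (G : Matrix (Fin k) (Fin n) R) : Prop :=
  ∀ e : Fin k → Fin n, Function.Injective e → IsUnit (G.submatrix id e).det

theorem mem_rowCode {G : Matrix (Fin k) (Fin n) R} {c : Fin n → R} :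
    c ∈ rowCode G ↔ ∃ x : Fin k → R, x ᵥ* G = c := by
  rw [rowCode, Submodule.mem_span_range_iff_exists_fun]
  refine exists_congr fun x => ?_
  rw [Matrix.vecMul_eq_sum]

theorem vecMul_comp (G : Matrix (Fin k) (Fin n) R) (x : Fin k → R) (e : Fin k → Fin n) :
    (fun j => (x ᵥ* G) (e j)) = x ᵥ* G.submatrix id e := rfl

theorem HasUnitMinors.exists_vecMul_eq {G : Matrix (Fin k) (Fin n) R} (hG : HasUnitMinors G)
    {e : Fin k → Fin n} (he : Function.Injective e) (y : Fin k → R) :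
    ∃ x : Fin k → R, ∀ j, (x ᵥ* G) (e j) = y j := by
  refine ⟨y ᵥ* (G.submatrix id e)⁻¹, fun j => ?_⟩
  have := congrFun (vecMul_comp G (y ᵥ* (G.submatrix id e)⁻¹) e) j
  rw [this, Matrix.vecMul_vecMul, Matrix.nonsing_inv_mul _ (hG e he), Matrix.vecMul_one]

theorem HasUnitMinors.eq_zero {G : Matrix (Fin k) (Fin n) R} (hG : HasUnitMinors G)
    {e : Fin k → Fin n} (he : Function.Injective e) {x : Fin k → R}
    (h : ∀ j, (x ᵥ* G) (e j) = 0) : x = 0 := by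
  have h0 : x ᵥ* G.submatrix id e = 0 := by rw [← vecMul_comp]; exact funext h
  have := congrArg (· ᵥ* (G.submatrix id e)⁻¹) h0
  simpa [Matrix.vecMul_vecMul, Matrix.mul_nonsing_inv _ (hG e he)] using this

theorem HasUnitMinors.vecMul_injective {G : Matrix (Fin k) (Fin n) R} (hG : HasUnitMinors G)
    (hkn : k ≤ n) : Function.Injective fun x : Fin k → R => x ᵥ* G := by
  intro x y hxy
  refine sub_eq_zero.1 (hG.eq_zero (Fin.castLE_injective hkn) fun j => ?_)
  rw [Matrix.sub_vecMul, sub_eq_zero.2 hxy]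
  rfl

theorem HasUnitMinors.card_rowCode {G : Matrix (Fin k) (Fin n) R} (hG : HasUnitMinors G)
    (hkn : k ≤ n) : Nat.card (rowCode G) = Nat.card R ^ k := by
  have h : (rowCode G : Set (Fin n → R)) = Set.range fun x : Fin k → R => x ᵥ* G := by
    ext c
    simp [mem_rowCode]
  have h2 : Nat.card (rowCode G) = Nat.card (Set.range fun x : Fin k → R => x ᵥ* G) :=
    Nat.card_congr (Equiv.setCongr h)
  rw [h2, Nat.card_range_of_injective (hG.vecMul_injective hkn), Nat.card_fun, Nat.card_fin]

/-- Multiplying by the inverse of the block of the first k columns gives the systematic form and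
keeps the row space. -/
theorem HasUnitMinors.hasTypeOne {G : Matrix (Fin k) (Fin n) R} (hG : HasUnitMinors G)
    (hkn : k ≤ n) : HasTypeOne (rowCode G) k := by
  have hn : k + (n - k) = n := by omega
  let σ : Fin k ⊕ Fin (n - k) ≃ Fin n := finSumFinEquiv.trans (finCongr hn)
  have hσ : Function.Injective fun i => σ (Sum.inl i) := σ.injective.comp Sum.inl_injective
  set U := G.submatrix id (fun i => σ (Sum.inl i)) with hU
  have hdet : IsUnit U.det := hG _ hσ
  have key : ∀ i, (fun j : Fin n => Matrix.fromCols (1 : Matrix (Fin k) (Fin k) R)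
      (U⁻¹ * G.submatrix id (fun i => σ (Sum.inr i))) i (σ.symm j)) = (U⁻¹ * G) i := by
    intro i
    funext j
    obtain ⟨j, rfl⟩ := σ.surjective j
    rw [Equiv.symm_apply_apply]
    rcases j with j | j
    · rw [Matrix.fromCols_apply_inl, ← Matrix.nonsing_inv_mul U hdet]
      rfl
    · rw [Matrix.fromCols_apply_inr]
      rfl
  refine ⟨σ, U⁻¹ * G.submatrix id (fun i => σ (Sum.inr i)), ?_⟩
  refine Eq.trans (b := rowCode (U⁻¹ * G)) ?_
    (congrArg (fun M => Submodule.span R (Set.range M)) (funext key).symm)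
  ext c
  rw [mem_rowCode, mem_rowCode]
  constructor
  · rintro ⟨x, rfl⟩
    exact ⟨x ᵥ* U, by rw [Matrix.vecMul_vecMul, ← Matrix.mul_assoc,
      Matrix.mul_nonsing_inv U hdet, Matrix.one_mul]⟩
  · rintro ⟨x, rfl⟩
    exact ⟨x ᵥ* U⁻¹, by rw [Matrix.vecMul_vecMul]⟩

-- A word of weight at most n - k vanishes at k coordinates, and any k coordinates determine the
-- word.
open Classical in
theorem HasUnitMinors.le_hammingNorm {G : Matrix (Fin k) (Fin n) R} (hG : HasUnitMinors G)
    {c : Fin n → R} (hc : c ∈ rowCode G) (hc0 : c ≠ 0) : n + 1 ≤ hammingNorm c + k := by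
  by_contra! hlt
  obtain ⟨x, rfl⟩ := mem_rowCode.1 hc
  let s : Finset (Fin n) := Finset.univ.filter fun j => (x ᵥ* G) j = 0
  have hs : k ≤ s.card := by
    have h := Finset.card_filter_add_card_filter_not (s := (Finset.univ : Finset (Fin n)))
      (p := fun j => (x ᵥ* G) j = 0)
    rw [Finset.card_univ, Fintype.card_fin] at h
    simp only [hammingNorm, ne_eq] at hlt
    change s.card + _ = n at h
    omega
  obtain ⟨t, hts, htc⟩ := Finset.exists_subset_card_eq hs
  have hx : x = 0 := hG.eq_zero (t.orderEmbOfFin htc).injective fun j =>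
    (Finset.mem_filter.1 (hts (Finset.orderEmbOfFin_mem t htc j))).2
  exact hc0 (by rw [hx, Matrix.zero_vecMul])

-- Interpolation gives a word that is 1 at the first coordinate and 0 at the next k - 1.
open Classical in
theorem HasUnitMinors.exists_hammingNorm_le [Nontrivial R] {G : Matrix (Fin k) (Fin n) R}
    (hG : HasUnitMinors G) (hk : 0 < k) (hkn : k ≤ n) :
    ∃ c ∈ rowCode G, c ≠ 0 ∧ hammingNorm c + k ≤ n + 1 := by
  obtain ⟨x, hx⟩ := hG.exists_vecMul_eq (Fin.castLE_injective hkn) (Pi.single ⟨0, hk⟩ 1)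
  refine ⟨x ᵥ* G, mem_rowCode.2 ⟨x, rfl⟩, fun h => ?_, ?_⟩
  · have := hx ⟨0, hk⟩
    simp [h] at this
  · have hsub : Finset.univ.image (fun j : Fin (k - 1) =>
        (⟨j + 1, by omega⟩ : Fin n)) ⊆ Finset.univ.filter fun j => (x ᵥ* G) j = 0 := by
      intro j hj
      obtain ⟨i, -, rfl⟩ := Finset.mem_image.1 hj
      refine Finset.mem_filter.2 ⟨Finset.mem_univ _, ?_⟩
      have h1 := hx ⟨i + 1, by omega⟩
      rw [Pi.single_eq_of_ne (by simp [Fin.ext_iff])] at h1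
      exact h1
    have hcard := Finset.card_le_card hsub
    rw [Finset.card_image_of_injective _ (by intro i j h; simpa [Fin.ext_iff] using h),
      Finset.card_univ, Fintype.card_fin] at hcard
    have h := Finset.card_filter_add_card_filter_not (s := (Finset.univ : Finset (Fin n)))
      (p := fun j => (x ᵥ* G) j = 0)
    rw [Finset.card_univ, Fintype.card_fin] at h
    simp only [hammingNorm, ne_eq]
    omega

theorem HasUnitMinors.minDist_add [Nontrivial R] {G : Matrix (Fin k) (Fin n) R}
    (hG : HasUnitMinors G) (hk : 0 < k) (hkn : k ≤ n) : minDist (rowCode G) + k = n + 1 := by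
  classical
  obtain ⟨c, hc, hc0, hle⟩ := hG.exists_hammingNorm_le hk hkn
  have hmem : hammingNorm c ∈ {w : ℕ | ∃ c ∈ rowCode G, c ≠ 0 ∧ hammingNorm c = w} :=
    ⟨c, hc, hc0, rfl⟩
  obtain ⟨c', hc', hc0', h⟩ := Nat.sInf_mem ⟨_, hmem⟩
  have h1 := Nat.sInf_le hmem
  have h2 := hG.le_hammingNorm hc' hc0'
  rw [h] at h2
  -- The two sides differ at most in the decidability instances behind `hammingNorm`.
  have h3 : minDist (rowCode G) =
      sInf {w : ℕ | ∃ c ∈ rowCode G, c ≠ 0 ∧ hammingNorm c = w} := by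
    unfold minDist
    congr!
  omega

theorem HasUnitMinors.isMDS [Nontrivial R] {G : Matrix (Fin k) (Fin n) R}
    (hG : HasUnitMinors G) (hk : 0 < k) (hkn : k ≤ n) : IsMDS (rowCode G) := by
  have hd := hG.minDist_add hk hkn
  refine ⟨fun _ => ?_, fun _ => ⟨k, hG.hasTypeOne hkn, hd⟩⟩
  have h1 : 1 < Nat.card R := Finite.one_lt_card
  have hlog : Real.log (Nat.card R) ≠ 0 := (Real.log_pos (by exact_mod_cast h1)).ne'
  rw [MeetsSingletonBound, hG.card_rowCode hkn, Nat.cast_pow, Real.logb, Real.log_pow,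
    mul_div_cancel_right₀ _ hlog]
  have : (minDist (rowCode G) : ℝ) + k = n + 1 := by exact_mod_cast hd
  linarith

/-- No cardinalities are compared, so R may be infinite. Subtract from a dual vector the codeword
that agrees with it on the first half; the remainder lives on the second half and is killed by an
invertible k × k block. -/
theorem HasUnitMinors.isSelfDual {G : Matrix (Fin k) (Fin n) R} (hG : HasUnitMinors G)
    (hn : n = 2 * k) (horth : G * Gᵀ = 0) : IsSelfDual (rowCode G) := by
  have hle : ∀ v ∈ rowCode G, v ∈ dualCode (rowCode G) := by
    intro v hv w hw
    obtain ⟨x, rfl⟩ := mem_rowCode.1 hv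
    obtain ⟨y, rfl⟩ := mem_rowCode.1 hw
    rw [← Matrix.mulVec_transpose G y, Matrix.dotProduct_mulVec, Matrix.vecMul_vecMul, horth,
      Matrix.vecMul_zero, zero_dotProduct]
  refine le_antisymm hle fun v hv => ?_
  let e₁ : Fin k → Fin n := fun j => ⟨j, by omega⟩
  let e₂ : Fin k → Fin n := fun j => ⟨j + k, by omega⟩
  have he₁ : Function.Injective e₁ := fun i j h => by simpa [e₁, Fin.ext_iff] using h
  have he₂ : Function.Injective e₂ := fun i j h => by simpa [e₂, Fin.ext_iff] using h
  obtain ⟨x, hx⟩ := hG.exists_vecMul_eq he₁ fun j => v (e₁ j)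
  have hxC : x ᵥ* G ∈ rowCode G := mem_rowCode.2 ⟨x, rfl⟩
  set w := v - x ᵥ* G with hw
  have hwd : w ∈ dualCode (rowCode G) := Submodule.sub_mem _ hv (hle _ hxC)
  have hw₁ : ∀ j, w (e₁ j) = 0 := fun j => by simp [hw, hx]
  have hsplit : ∀ f : Fin n → R, ∑ j, f j = ∑ j, f (e₁ j) + ∑ j, f (e₂ j) := by
    intro f
    subst hn
    rw [← (finSumFinEquiv.trans (finCongr (two_mul k).symm)).sum_comp, Fintype.sum_sum_type]
    congr 1
    refine Finset.sum_congr rfl fun j _ => congrArg f (Fin.ext ?_)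
    simp [e₂, add_comm]
  have hw₂ : G.submatrix id e₂ *ᵥ (fun j => w (e₂ j)) = 0 := by
    funext i
    have h := hwd (G i) (Submodule.subset_span ⟨i, rfl⟩)
    rw [dotProduct, hsplit] at h
    simp only [hw₁, zero_mul, Finset.sum_const_zero, zero_add] at h
    rw [Pi.zero_apply, ← h]
    simp [Matrix.mulVec, dotProduct, mul_comm]
  have hw₃ : ∀ j, w (e₂ j) = 0 := by
    have h := congrArg ((G.submatrix id e₂)⁻¹ *ᵥ ·) hw₂
    simp only [Matrix.mulVec_mulVec, Matrix.nonsing_inv_mul _ (hG e₂ he₂), Matrix.one_mulVec,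
      Matrix.mulVec_zero] at h
    exact fun j => congrFun h j
  have hw0 : w = 0 := by
    funext j
    by_cases hj : (j : ℕ) < k
    · exact hw₁ ⟨j, hj⟩
    · have h := hw₃ ⟨j - k, by omega⟩
      have hj' : e₂ ⟨j - k, by omega⟩ = j := Fin.ext (by simp [e₂]; omega)
      rwa [hj'] at h
  rw [sub_eq_zero.1 hw0]
  exact hxC

end GeneratorMatrix

/-! ### Powers of a + √d in coordinates. -/

section TorusSequence

variable {R S : Type*} [CommRing R] [CommRing S]

/-- The coordinates `(x, y)` of the power `(a + √d) ^ t = x + y √d`. -/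
def torusPow (a d : R) : ℕ → R × R
  | 0 => (1, 0)
  | t + 1 => (a * (torusPow a d t).1 + d * (torusPow a d t).2,
      (torusPow a d t).1 + a * (torusPow a d t).2)

/-- The rational part of `(a + √d) ^ t`. -/
def torusRe (a d : R) (t : ℕ) : R := (torusPow a d t).1

/-- The coefficient of `√d` in `(a + √d) ^ t`. -/
def torusIm (a d : R) (t : ℕ) : R := (torusPow a d t).2

variable (a d : R)

@[simp] theorem torusRe_zero : torusRe a d 0 = 1 := rfl

@[simp] theorem torusIm_zero : torusIm a d 0 = 0 := rfl

theorem torusRe_succ (t : ℕ) :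
    torusRe a d (t + 1) = a * torusRe a d t + d * torusIm a d t := rfl

theorem torusIm_succ (t : ℕ) :
    torusIm a d (t + 1) = torusRe a d t + a * torusIm a d t := rfl

theorem map_torusRe_and_torusIm (f : R →+* S) (t : ℕ) :
    f (torusRe a d t) = torusRe (f a) (f d) t ∧ f (torusIm a d t) = torusIm (f a) (f d) t := by
  induction t with
  | zero => simp
  | succ t ih => simp [torusRe_succ, torusIm_succ, ih.1, ih.2]

theorem map_torusRe (f : R →+* S) (t : ℕ) :
    f (torusRe a d t) = torusRe (f a) (f d) t := (map_torusRe_and_torusIm a d f t).1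

theorem map_torusIm (f : R →+* S) (t : ℕ) :
    f (torusIm a d t) = torusIm (f a) (f d) t := (map_torusRe_and_torusIm a d f t).2

variable {d} in
theorem torusRe_add_mul_torusIm {r : R} (hr : r ^ 2 = d) (t : ℕ) :
    torusRe a d t + r * torusIm a d t = (a + r) ^ t := by
  induction t with
  | zero => simp
  | succ t ih =>
    rw [pow_succ, ← ih, torusRe_succ, torusIm_succ, ← hr]
    ring

variable {d} in
theorem torusRe_sub_mul_torusIm {r : R} (hr : r ^ 2 = d) (t : ℕ) :
    torusRe a d t - r * torusIm a d t = (a - r) ^ t := by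
  have := torusRe_add_mul_torusIm a (r := -r) (by rw [neg_sq, hr]) t
  rw [sub_eq_add_neg a, ← this]
  ring

theorem torusRe_add_and_torusIm_add (s t : ℕ) :
    torusRe a d (s + t) = torusRe a d s * torusRe a d t + d * torusIm a d s * torusIm a d t ∧
    torusIm a d (s + t) = torusRe a d s * torusIm a d t + torusIm a d s * torusRe a d t := by
  induction t with
  | zero => simp
  | succ t ih =>
    rw [← add_assoc, torusRe_succ, torusIm_succ, torusRe_succ, torusIm_succ, ih.1, ih.2]
    constructor <;> ring

theorem torusRe_add (s t : ℕ) : torusRe a d (s + t) =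
    torusRe a d s * torusRe a d t + d * torusIm a d s * torusIm a d t :=
  (torusRe_add_and_torusIm_add a d s t).1

theorem torusIm_add (s t : ℕ) : torusIm a d (s + t) =
    torusRe a d s * torusIm a d t + torusIm a d s * torusRe a d t :=
  (torusRe_add_and_torusIm_add a d s t).2

theorem torus_norm (t : ℕ) :
    torusRe a d t ^ 2 - d * torusIm a d t ^ 2 = (a ^ 2 - d) ^ t := by
  induction t with
  | zero => simp
  | succ t ih =>
    rw [pow_succ (a ^ 2 - d), ← ih, torusRe_succ, torusIm_succ]
    ring

/-- For w = a + √d, this compares the coefficients of √d in conj(w^s) w^(s+j) = N^s w^j. -/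
theorem torus_cross (s j : ℕ) :
    torusRe a d s * torusIm a d (s + j) - torusRe a d (s + j) * torusIm a d s =
      (a ^ 2 - d) ^ s * torusIm a d j := by
  rw [torusRe_add, torusIm_add, ← torus_norm]
  ring

/-- Dividing by a + √d is multiplying by a - √d, up to the norm. So a step back along the orbit is a
linear substitution. -/
theorem norm_mul_torusRe (t : ℕ) : (a ^ 2 - d) * torusRe a d t =
    a * torusRe a d (t + 1) + (-d) * torusIm a d (t + 1) := by
  rw [torusRe_succ, torusIm_succ]
  ring

theorem norm_mul_torusIm (t : ℕ) : (a ^ 2 - d) * torusIm a d t =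
    (-1) * torusRe a d (t + 1) + a * torusIm a d (t + 1) := by
  rw [torusRe_succ, torusIm_succ]
  ring

end TorusSequence

/-! ### The evaluation code on a torus orbit. -/

section TorusCode

variable {R : Type*} [CommRing R]

/-- The torus element `a + √d` has projective order `2 * k`, and `l` is a compatible multiplier. -/
structure IsTorusDatum (a d l : R) (k : ℕ) : Prop where
  pos : 0 < k
  isUnit_two : IsUnit (2 : R)
  isUnit_norm : IsUnit (a ^ 2 - d)
  isUnit_im : ∀ t, 0 < t → t < 2 * k → IsUnit (torusIm a d t)
  im_eq_zero : torusIm a d (2 * k) = 0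
  sq_mul_norm : l ^ 2 * (a ^ 2 - d) ^ (k - 1) = -1

/-- The generator matrix of the code of the words `l ^ t * F (x_t, y_t)`, where `F` runs through the
binary forms of degree `k - 1` and `x_t + y_t √d = (a + √d) ^ t`. -/
def torusMatrix (a d l : R) (k : ℕ) : Matrix (Fin k) (Fin (2 * k)) R :=
  Matrix.of fun i t => l ^ (t : ℕ) *
    (torusRe a d t ^ (i : ℕ) * torusIm a d t ^ (i.rev : ℕ))

namespace IsTorusDatum

variable {a d l : R} {k : ℕ}

theorem isUnit_multiplier (h : IsTorusDatum a d l k) : IsUnit l := by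
  have h1 : IsUnit (l * (l * (a ^ 2 - d) ^ (k - 1))) := by
    rw [← mul_assoc, ← sq, h.sq_mul_norm]
    exact isUnit_one.neg
  exact isUnit_of_mul_isUnit_left h1

theorem re_half (h : IsTorusDatum a d l k) : torusRe a d k = 0 := by
  have h1 := h.im_eq_zero
  have hk := h.pos
  rw [two_mul, torusIm_add] at h1
  have h2 : (2 * torusIm a d k) * torusRe a d k = 0 := by rw [← h1]; ring
  exact (IsUnit.mul_right_eq_zero (h.isUnit_two.mul (h.isUnit_im k hk (by omega)))).1 h2

theorem norm_pow (h : IsTorusDatum a d l k) : (a ^ 2 - d) ^ k = -(d * torusIm a d k ^ 2) := by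
  rw [← torus_norm, h.re_half]
  ring

theorem re_period (h : IsTorusDatum a d l k) : torusRe a d (2 * k) = -(a ^ 2 - d) ^ k := by
  rw [two_mul, torusRe_add, h.norm_pow, h.re_half]
  ring

theorem isUnit_disc (h : IsTorusDatum a d l k) : IsUnit d := by
  have h1 : IsUnit (d * torusIm a d k ^ 2) := by
    rw [← neg_neg (d * _), ← h.norm_pow]
    exact (h.isUnit_norm.pow k).neg
  exact isUnit_of_mul_isUnit_left h1

theorem sq_mul_re_period (h : IsTorusDatum a d l k) :
    l ^ 2 * torusRe a d (2 * k) = a ^ 2 - d := by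
  obtain ⟨m, rfl⟩ := Nat.exists_eq_add_of_lt h.pos
  have h1 := h.sq_mul_norm
  simp only [zero_add, add_tsub_cancel_right] at h1
  rw [h.re_period, zero_add, pow_succ]
  linear_combination (-(a ^ 2 - d)) * h1

/-- This is the constant picked up when the orbit closes after 2k steps: (-1)^(k-1) (l^2 N^(k-1))^k
= -1. -/
theorem multiplier_pow (h : IsTorusDatum a d l k) :
    l ^ (2 * k) * torusRe a d (2 * k) ^ (k - 1) = -1 := by
  obtain ⟨m, rfl⟩ := Nat.exists_eq_add_of_lt h.pos
  have h1 := h.sq_mul_norm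
  rw [h.re_period]
  simp only [zero_add, add_tsub_cancel_right] at h1 ⊢
  have h2 := congrArg (· ^ (m + 1)) h1
  simp only [mul_pow] at h2
  have h3 : ((-1 : R) ^ m) ^ 2 = 1 := by rw [← pow_mul, mul_comm, pow_mul, neg_one_sq, one_pow]
  rw [neg_pow]
  generalize a ^ 2 - d = N at h2 ⊢
  linear_combination (-1) ^ m * h2 - h3

theorem hasUnitMinors (h : IsTorusDatum a d l k) : HasUnitMinors (torusMatrix a d l k) := by
  intro e he
  have h1 : (torusMatrix a d l k).submatrix id e =
      (Matrix.of fun i j => l ^ (e i : ℕ) * Matrix.projVandermonde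
        (fun i => torusRe a d (e i)) (fun i => torusIm a d (e i)) i j)ᵀ := rfl
  rw [h1, Matrix.det_transpose, Matrix.det_mul_column, Matrix.det_projVandermonde]
  have hcross : ∀ s t : ℕ, s < t → t < 2 * k →
      IsUnit (torusRe a d s * torusIm a d t - torusRe a d t * torusIm a d s) := by
    intro s t hst ht
    obtain ⟨j, rfl⟩ := Nat.exists_eq_add_of_le hst.le
    rw [torus_cross]
    exact (h.isUnit_norm.pow s).mul (h.isUnit_im j (by omega) (by omega))
  refine IsUnit.mul (IsUnit.prod_univ_iff.2 fun i => h.isUnit_multiplier.pow _)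
    (IsUnit.prod_univ_iff.2 fun i => IsUnit.prod_iff.2 fun j hj => ?_)
  have hne : (e i : ℕ) ≠ e j := fun hij =>
    (Finset.mem_Ioi.1 hj).ne (he (Fin.ext hij))
  rcases lt_or_gt_of_ne hne with hlt | hlt
  · rw [← IsUnit.neg_iff, neg_sub]
    exact hcross _ _ hlt (e j).2
  · exact hcross _ _ hlt (e i).2

end IsTorusDatum

/-- A weighted sum that kills all monomials of degree m kills all forms of degree m; this is used to
pass from eigencoordinates back to x_t and y_t. -/
theorem sum_mul_add_pow_mul_sub_pow {S ι : Type*} [CommRing S] (s : Finset ι) (w x y : ι → S)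
    (m : ℕ) (h : ∀ b c, b + c = m → ∑ t ∈ s, w t * (x t ^ b * y t ^ c) = 0) (i j : ℕ) :
    ∀ b c, b + c + i + j = m →
      ∑ t ∈ s, w t * (x t ^ b * y t ^ c * (x t + y t) ^ i * (x t - y t) ^ j) = 0 := by
  induction j with
  | zero =>
    induction i with
    | zero => simpa using h
    | succ i ih =>
      intro b c hbc
      have h1 := ih (b + 1) c (by omega)
      have h2 := ih b (c + 1) (by omega)
      refine Eq.trans ?_ ((congrArg₂ (· + ·) h1 h2).trans (add_zero 0))
      rw [← Finset.sum_add_distrib]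
      exact Finset.sum_congr rfl fun t _ => by ring
  | succ j ih =>
    intro b c hbc
    have h1 := ih (b + 1) c (by omega)
    have h2 := ih b (c + 1) (by omega)
    refine Eq.trans ?_ ((congrArg₂ (· - ·) h1 h2).trans (sub_zero 0))
    rw [← Finset.sum_sub_distrib]
    exact Finset.sum_congr rfl fun t _ => by ring

namespace IsTorusDatum

variable {a d l : R} {k : ℕ}

/-- In the eigencoordinates u^t, v^t every monomial gives a geometric sum with ratio z, where z^(2k)
= 1 and z - 1 is a unit. -/
theorem sum_split_eq_zero {r : R} (h : IsTorusDatum a d l k) (hr : r ^ 2 = d) (b c : ℕ)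
    (hbc : b + c = 2 * k - 2) :
    ∑ t ∈ Finset.range (2 * k), (l ^ 2) ^ t * (((a + r) ^ t) ^ b * ((a - r) ^ t) ^ c) = 0 := by
  have hk := h.pos
  set u := a + r with hu
  set v := a - r with hv
  have hu' : u ^ (2 * k) = torusRe a d (2 * k) := by
    rw [hu, ← torusRe_add_mul_torusIm a hr, h.im_eq_zero]
    ring
  have hv' : v ^ (2 * k) = torusRe a d (2 * k) := by
    rw [hv, ← torusRe_sub_mul_torusIm a hr, h.im_eq_zero]
    ring
  have huv : u * v = a ^ 2 - d := by rw [hu, hv, ← hr]; ring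
  set z := l ^ 2 * (u ^ b * v ^ c) with hz
  have hsum : ∑ t ∈ Finset.range (2 * k), (l ^ 2) ^ t * ((u ^ t) ^ b * (v ^ t) ^ c) =
      ∑ t ∈ Finset.range (2 * k), z ^ t :=
    Finset.sum_congr rfl fun t _ => by rw [hz]; ring
  have hzpow : z ^ (2 * k) = 1 := by
    have h1 : z ^ (2 * k) = (l ^ (2 * k)) ^ 2 * ((u ^ (2 * k)) ^ b * (v ^ (2 * k)) ^ c) := by
      rw [hz]; ring
    rw [h1, hu', hv', ← pow_add, hbc, show 2 * k - 2 = (k - 1) * 2 by omega, pow_mul _ (k - 1),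
      ← mul_pow, h.multiplier_pow]
    ring
  -- Since l^2 v^(2k) = N = uv, the ratio is z = (u/v)^(b+1), with 0 < b + 1 < 2k.
  have hzv : (z - 1) * v ^ (b + 1) = 2 * r * torusIm a d (b + 1) := by
    have h1 : z * v ^ (b + 1) = u ^ (b + 1) := by
      have h2 : z * v ^ (b + 1) = l ^ 2 * u ^ b * v ^ (2 * k - 1) := by
        rw [show 2 * k - 1 = c + (b + 1) by omega, hz]; ring
      have hvu : IsUnit v := isUnit_of_mul_isUnit_right (huv ▸ h.isUnit_norm)
      refine hvu.mul_left_injective ?_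
      dsimp only
      have h3 : v ^ (2 * k - 1) * v = v ^ (2 * k) := by
        rw [← pow_succ]; congr 1; omega
      calc z * v ^ (b + 1) * v = u ^ b * (l ^ 2 * (v ^ (2 * k - 1) * v)) := by rw [h2]; ring
        _ = u ^ b * (u * v) := by rw [h3, hv', h.sq_mul_re_period, huv]
        _ = u ^ (b + 1) * v := by ring
    rw [sub_mul, h1, one_mul, hu, hv, ← torusRe_add_mul_torusIm a hr,
      ← torusRe_sub_mul_torusIm a hr]
    ring
  have hru : IsUnit r := by
    refine isUnit_of_mul_isUnit_left (y := r) ?_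
    rw [← sq, hr]
    exact h.isUnit_disc
  have hzu : IsUnit (z - 1) := by
    refine isUnit_of_mul_isUnit_left (y := v ^ (b + 1)) ?_
    rw [hzv]
    exact (h.isUnit_two.mul hru).mul (h.isUnit_im _ (by omega) (by omega))
  rw [hsum]
  refine (hzu.mul_right_eq_zero).1 ?_
  rw [mul_geom_sum, hzpow, sub_self]

theorem sum_eq_zero_of_sqrt {r : R} (h : IsTorusDatum a d l k) (hr : r ^ 2 = d) (i j : ℕ)
    (hij : i + j = 2 * k - 2) :
    ∑ t ∈ Finset.range (2 * k), (l ^ 2) ^ t * (torusRe a d t ^ i * torusIm a d t ^ j) = 0 := by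
  have hru : IsUnit r := by
    refine isUnit_of_mul_isUnit_left (y := r) ?_
    rw [← sq, hr]
    exact h.isUnit_disc
  -- Clear denominators in 2 x_t = u^t + v^t and 2 r y_t = u^t - v^t.
  refine (((h.isUnit_two.pow i).mul ((h.isUnit_two.mul hru).pow j)).mul_right_eq_zero).1 ?_
  rw [← sum_mul_add_pow_mul_sub_pow (Finset.range (2 * k)) (fun t => (l ^ 2) ^ t)
    (fun t => (a + r) ^ t) (fun t => (a - r) ^ t) (2 * k - 2)
    (h.sum_split_eq_zero hr) i j 0 0 (by omega), Finset.mul_sum]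
  refine Finset.sum_congr rfl fun t _ => ?_
  rw [← torusRe_add_mul_torusIm a hr, ← torusRe_sub_mul_torusIm a hr]
  ring

theorem map {S : Type*} [CommRing S] (f : R →+* S) (h : IsTorusDatum a d l k) :
    IsTorusDatum (f a) (f d) (f l) k where
  pos := h.pos
  isUnit_two := by simpa only [map_ofNat] using h.isUnit_two.map f
  isUnit_norm := by simpa using h.isUnit_norm.map f
  isUnit_im t h0 h1 := by rw [← map_torusIm]; exact (h.isUnit_im t h0 h1).map f
  im_eq_zero := by rw [← map_torusIm, h.im_eq_zero, map_zero]
  sq_mul_norm := by simpa using congrArg f h.sq_mul_norm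

/-- A square root of d can be adjoined formally: R embeds in R[√d], and the split argument needs
only units there, not a domain. -/
theorem sum_eq_zero (h : IsTorusDatum a d l k) (i j : ℕ) (hij : i + j = 2 * k - 2) :
    ∑ t ∈ Finset.range (2 * k), (l ^ 2) ^ t * (torusRe a d t ^ i * torusIm a d t ^ j) = 0 := by
  let S := QuadraticAlgebra R d 0
  let f : R →+* S := algebraMap R S
  have hf : Function.Injective f := QuadraticAlgebra.C_injective
  have hr : (⟨0, 1⟩ : S) ^ 2 = f d := by
    rw [sq, QuadraticAlgebra.mk_mul_mk]
    change _ = (QuadraticAlgebra.C d : S)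
    ext <;> simp
  apply hf
  have h1 := (h.map f).sum_eq_zero_of_sqrt hr i j hij
  rw [map_zero, ← h1, map_sum]
  simp only [map_mul, map_pow, map_torusRe, map_torusIm]

theorem mul_transpose (h : IsTorusDatum a d l k) :
    torusMatrix a d l k * (torusMatrix a d l k)ᵀ = 0 := by
  ext i j
  have h1 := h.sum_eq_zero (i + j) (i.rev + j.rev) (by simp only [Fin.val_rev]; omega)
  rw [← Fin.sum_univ_eq_sum_range
    (fun t => (l ^ 2) ^ t * (torusRe a d t ^ (i + j : ℕ) * torusIm a d t ^ (i.rev + j.rev : ℕ)))]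
    at h1
  rw [Matrix.zero_apply, ← h1, Matrix.mul_apply]
  refine Finset.sum_congr rfl fun t _ => ?_
  simp only [torusMatrix, Matrix.transpose_apply, Matrix.of_apply]
  ring

end IsTorusDatum

/-- The code of `torusMatrix` contains the values of all products of linear forms. -/
theorem torusForm_mem (a d l : R) (k : ℕ) (α β γ δ : R) (i j : ℕ) :
    ∀ b c, b + c + i + j + 1 = k →
      (fun t : Fin (2 * k) => l ^ (t : ℕ) * (torusRe a d t ^ b * torusIm a d t ^ c *
        (α * torusRe a d t + β * torusIm a d t) ^ i *
        (γ * torusRe a d t + δ * torusIm a d t) ^ j)) ∈ rowCode (torusMatrix a d l k) := by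
  induction j with
  | zero =>
    induction i with
    | zero =>
      intro b c hbc
      refine Submodule.subset_span ⟨⟨b, by omega⟩, ?_⟩
      funext t
      simp only [torusMatrix, Matrix.of_apply, Fin.val_rev, pow_zero, mul_one]
      rw [show k - (b + 1) = c by omega]
    | succ i ih =>
      intro b c hbc
      have h1 := Submodule.smul_mem _ α (ih (b + 1) c (by omega))
      have h2 := Submodule.smul_mem _ β (ih b (c + 1) (by omega))
      convert! Submodule.add_mem _ h1 h2 using 1
      funext t
      simp only [Pi.add_apply, Pi.smul_apply, smul_eq_mul]
      ring
  | succ j ih =>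
    intro b c hbc
    have h1 := Submodule.smul_mem _ γ (ih (b + 1) c (by omega))
    have h2 := Submodule.smul_mem _ δ (ih b (c + 1) (by omega))
    convert! Submodule.add_mem _ h1 h2 using 1
    funext t
    simp only [Pi.add_apply, Pi.smul_apply, smul_eq_mul]
    ring

/-- Each of the k - 1 linear factors absorbs one N, and l turns l^s into l^(s+1). Coordinate 0 is
the wrap-around, where `multiplier_pow` produces the sign. -/
theorem IsTorusDatum.shift_row {a d l : R} {k : ℕ} (h : IsTorusDatum a d l k) (i : Fin k)
    (t : Fin (2 * k)) :
    l * (a ^ 2 - d) ^ (k - 1) * constacyclicShift (-1) (torusMatrix a d l k i) t =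
      l ^ (t : ℕ) * (torusRe a d t ^ 0 * torusIm a d t ^ 0 *
        (a * torusRe a d t + (-d) * torusIm a d t) ^ (i : ℕ) *
        ((-1) * torusRe a d t + a * torusIm a d t) ^ (i.rev : ℕ)) := by
  have hk := h.pos
  have hdeg : k - 1 = i + i.rev := by rw [Fin.val_rev]; omega
  obtain ⟨t, ht⟩ := t
  have key : ∀ s, l * (a ^ 2 - d) ^ (k - 1) *
      (l ^ s * (torusRe a d s ^ (i : ℕ) * torusIm a d s ^ (i.rev : ℕ))) =
      l ^ (s + 1) * ((a * torusRe a d (s + 1) + (-d) * torusIm a d (s + 1)) ^ (i : ℕ) *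
        ((-1) * torusRe a d (s + 1) + a * torusIm a d (s + 1)) ^ (i.rev : ℕ)) := by
    intro s
    rw [← norm_mul_torusRe, ← norm_mul_torusIm, hdeg, mul_pow, mul_pow]
    ring
  rcases t with _ | s
  · have h1 := key (2 * k - 1)
    rw [show 2 * k - 1 + 1 = 2 * k by omega, h.im_eq_zero] at h1
    simp only [constacyclicShift, torusMatrix, Matrix.of_apply, if_true, torusRe_zero,
      torusIm_zero]
    rw [neg_one_mul, mul_neg, h1]
    have h2 := h.multiplier_pow
    rw [hdeg, pow_add] at h2
    linear_combination (-(a ^ (i : ℕ) * (-1) ^ (i.rev : ℕ))) * h2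
  · simp only [constacyclicShift, torusMatrix, Matrix.of_apply, Nat.add_eq_zero_iff, one_ne_zero,
      and_false, if_false, Nat.add_sub_cancel]
    rw [key s]
    ring

theorem IsTorusDatum.isNegacyclic {a d l : R} {k : ℕ} (h : IsTorusDatum a d l k) :
    IsNegacyclic (rowCode (torusMatrix a d l k)) := by
  intro c hc
  induction hc using Submodule.span_induction with
  | mem c hc =>
    obtain ⟨i, rfl⟩ := hc
    -- By `sq_mul_norm`, -l is the inverse of the factor l N^(k-1) in `shift_row`.
    have h1 := Submodule.smul_mem _ (-l) (torusForm_mem a d l k a (-d) (-1) a i i.rev 0 0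
      (by rw [Fin.val_rev]; omega))
    convert! h1 using 1
    funext t
    rw [Pi.smul_apply, smul_eq_mul, ← h.shift_row i t]
    linear_combination (constacyclicShift (-1) (torusMatrix a d l k i) t) * h.sq_mul_norm
  | zero =>
    convert! Submodule.zero_mem (rowCode (torusMatrix a d l k)) using 1
    funext t
    simp [constacyclicShift]
  | add x y _ _ hx hy =>
    convert! Submodule.add_mem _ hx hy using 1
    funext t
    simp only [constacyclicShift, Pi.add_apply]
    split_ifs <;> ring
  | smul r x _ hx =>
    convert! Submodule.smul_mem _ r hx using 1
    funext t
    simp only [constacyclicShift, Pi.smul_apply, smul_eq_mul]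
    split_ifs <;> ring

theorem IsTorusDatum.exists_code [Nontrivial R] {a d l : R} {k : ℕ} (h : IsTorusDatum a d l k) :
    ∃ C : Submodule R (Fin (2 * k) → R), IsNegacyclic C ∧ IsMDS C ∧ IsSelfDual C :=
  ⟨rowCode (torusMatrix a d l k), h.isNegacyclic, h.hasUnitMinors.isMDS h.pos (by omega),
    h.hasUnitMinors.isSelfDual rfl h.mul_transpose⟩

end TorusCode

/-! ### Hensel lifting from the residue field to the chain ring. -/

section Lifting

open Polynomial

theorem isAdicComplete_of_pow_eq_bot {R : Type*} [CommRing R] {I : Ideal R} {m : ℕ}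
    (h : I ^ m = ⊥) : IsAdicComplete I R where
  haus' x hx := by
    have := hx m
    rwa [h, Submodule.bot_smul, SModEq.bot] at this
  prec' f hf := by
    refine ⟨f m, fun n => ?_⟩
    rcases le_total n m with hnm | hmn
    · exact hf hnm
    · have := hf hmn
      rw [h, Submodule.bot_smul, SModEq.bot] at this
      rw [this]

/-- In the finite case the ring is Artinian, so its maximal ideal is nilpotent and completeness is
automatic. -/
theorem IsChainRing.henselianLocalRing {R : Type*} [CommRing R] [IsLocalRing R]
    (h : IsChainRing R) : HenselianLocalRing R := by
  have hc : IsAdicComplete (IsLocalRing.maximalIdeal R) R := by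
    rcases h with ⟨_, -, -⟩ | ⟨_, _, h⟩
    · obtain ⟨m, hm⟩ := IsArtinianRing.isNilpotent_jacobson_bot (R := R)
      rw [IsLocalRing.jacobson_eq_maximalIdeal ⊥ bot_ne_top] at hm
      exact isAdicComplete_of_pow_eq_bot hm
    · exact h
  exact ⟨fun f hf a₀ h₀ h₁ => HenselianRing.is_henselian (I := IsLocalRing.maximalIdeal R)
    f hf a₀ h₀ (h₁.map _)⟩

theorem HenselianLocalRing.exists_lift_root {R : Type*} [CommRing R] [HenselianLocalRing R]
    {f : R[X]} (hf : f.Monic) {x : IsLocalRing.ResidueField R}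
    (hx : f.eval₂ (IsLocalRing.residue R) x = 0)
    (hx' : (derivative f).eval₂ (IsLocalRing.residue R) x ≠ 0) :
    ∃ y : R, f.eval y = 0 ∧ IsLocalRing.residue R y = x := by
  obtain ⟨a₀, rfl⟩ := IsLocalRing.residue_surjective x
  rw [eval₂_at_apply] at hx hx'
  obtain ⟨y, hy, hya⟩ := HenselianLocalRing.is_henselian f hf a₀
    ((IsLocalRing.residue_eq_zero_iff _).1 hx) ((IsLocalRing.residue_ne_zero_iff_isUnit _).1 hx')
  refine ⟨y, hy, ?_⟩
  rw [← sub_eq_zero, ← map_sub]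
  exact (IsLocalRing.residue_eq_zero_iff _).2 hya

variable {R : Type*} [CommRing R] (d : R)

/-- Formally, this differentiates (X + √d)^(t+1). -/
theorem derivative_torus (t : ℕ) :
    derivative (torusRe X (C d) (t + 1)) = (t + 1 : R[X]) * torusRe X (C d) t ∧
    derivative (torusIm X (C d) (t + 1)) = (t + 1 : R[X]) * torusIm X (C d) t := by
  induction t with
  | zero => simp [torusRe_succ, torusIm_succ]
  | succ t ih =>
    rw [torusRe_succ X (C d) (t + 1), torusIm_succ X (C d) (t + 1)]
    simp only [derivative_add, derivative_mul, derivative_X, derivative_C, ih.1, ih.2]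
    rw [torusRe_succ, torusIm_succ]
    push_cast
    constructor <;> ring

theorem natDegree_and_coeff_torus (t : ℕ) :
    (torusRe X (C d) t).natDegree ≤ t ∧ (torusRe X (C d) t).coeff t = 1 ∧
    (torusIm X (C d) t).natDegree ≤ t ∧
    (torusIm X (C d) (t + 1)).natDegree ≤ t ∧ (torusIm X (C d) (t + 1)).coeff t = t + 1 := by
  induction t with
  | zero => simp [torusIm_succ]
  | succ t ih =>
    obtain ⟨h1, h2, h3, h4, h5⟩ := ih
    have hX : ∀ {f : R[X]} {m : ℕ}, f.natDegree ≤ m → (X * f).natDegree ≤ m + 1 := by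
      intro f m hf
      rw [add_comm]
      exact natDegree_mul_le_of_le natDegree_X_le hf
    have h6 : (torusRe X (C d) (t + 1)).natDegree ≤ t + 1 := by
      rw [torusRe_succ]
      exact natDegree_add_le_of_degree_le (hX h1)
        ((natDegree_C_mul_le _ _).trans (h3.trans t.le_succ))
    have h7 : (torusRe X (C d) (t + 1)).coeff (t + 1) = 1 := by
      rw [torusRe_succ, coeff_add, coeff_X_mul, coeff_C_mul, h2,
        coeff_eq_zero_of_natDegree_lt (p := torusIm X (C d) t) (by omega)]
      simp
    refine ⟨h6, h7, h4.trans t.le_succ, ?_, ?_⟩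
    · rw [torusIm_succ]
      exact natDegree_add_le_of_degree_le h6 (hX h4)
    · rw [torusIm_succ, coeff_add, coeff_X_mul, h5, h7]
      push_cast
      ring

theorem eval₂_torusIm {S : Type*} [CommRing S] (f : R →+* S) (a : S) (t : ℕ) :
    (torusIm X (C d) t).eval₂ f a = torusIm a (f d) t := by
  have := map_torusIm X (C d) (eval₂RingHom f a) t
  simpa using this

/-- Lift d arbitrarily, then a as a simple root of the √d-coefficient of (X + √d)^(2k), then l as a
square root of -N^(-(k-1)). Unit conditions can be checked in the residue field. -/
theorem IsTorusDatum.exists_lift {R : Type*} [CommRing R] [HenselianLocalRing R]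
    {a₀ d₀ l₀ : IsLocalRing.ResidueField R} {k : ℕ} (h : IsTorusDatum a₀ d₀ l₀ k)
    (hk : ((2 * k : ℕ) : IsLocalRing.ResidueField R) ≠ 0) :
    ∃ a d l : R, IsTorusDatum a d l k := by
  have hpos := h.pos
  have hunit : ∀ {x : R}, IsLocalRing.residue R x ≠ 0 → IsUnit x :=
    fun hx => (IsLocalRing.residue_ne_zero_iff_isUnit _).1 hx
  have hnu : IsUnit ((2 * k : ℕ) : R) := hunit (by rwa [map_natCast])
  obtain ⟨d, rfl⟩ := IsLocalRing.residue_surjective d₀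
  obtain ⟨m, hm⟩ : ∃ m, 2 * k = m + 1 := ⟨2 * k - 1, by omega⟩
  -- The polynomial has leading coefficient 2k; c makes it monic.
  obtain ⟨c, hc⟩ := hnu.exists_left_inv
  have hc' : IsLocalRing.residue R c * ((2 * k : ℕ) : IsLocalRing.ResidueField R) = 1 := by
    simpa only [map_mul, map_natCast, map_one] using congrArg (IsLocalRing.residue R) hc
  have hc0 : IsLocalRing.residue R c ≠ 0 := left_ne_zero_of_mul_eq_one hc'
  have hdeg := natDegree_and_coeff_torus d m
  have hmonic : (C c * torusIm X (C d) (m + 1)).Monic := by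
    refine monic_of_natDegree_le_of_coeff_eq_one m
      ((natDegree_C_mul_le _ _).trans hdeg.2.2.2.1) ?_
    rw [coeff_C_mul, hdeg.2.2.2.2, ← Nat.cast_add_one, ← hm, hc]
  have hroot := h.im_eq_zero
  rw [hm] at hroot
  obtain ⟨a, ha, rfl⟩ := HenselianLocalRing.exists_lift_root hmonic (x := a₀)
    (by rw [eval₂_mul, eval₂_torusIm, hroot, mul_zero])
    -- The root is simple: the derivative is, up to c, 2k times the √d-coefficient of the power 2k -
    -- 1.
    (by
      rw [derivative_C_mul, (derivative_torus d m).2, eval₂_mul, eval₂_mul, eval₂_torusIm, eval₂_C]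
      refine mul_ne_zero hc0 (mul_ne_zero ?_ (h.isUnit_im m (by omega) (by omega)).ne_zero)
      rw [hm] at hk
      simpa [eval₂_add, eval₂_natCast] using hk)
  have hcu : IsUnit c := hunit hc0
  have him : torusIm a d (2 * k) = 0 := by
    rw [hm, ← (hcu.mul_right_eq_zero (b := torusIm a d (m + 1))), ← ha, eval_mul, eval_C,
      ← RingHom.id_apply d, ← eval₂_torusIm, RingHom.id_apply]
    rfl
  have hN : IsUnit (a ^ 2 - d) := hunit (by simpa using h.isUnit_norm.ne_zero)
  have h2 : IsUnit (2 : R) := hunit (by simpa only [map_ofNat] using h.isUnit_two.ne_zero)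
  obtain ⟨e, he⟩ := (hN.pow (k - 1)).exists_left_inv
  have he' := congrArg (IsLocalRing.residue R) he
  simp only [map_mul, map_pow, map_sub, map_one] at he'
  have hl := h.sq_mul_norm
  have hsq : l₀ ^ 2 = -IsLocalRing.residue R e := by
    linear_combination (IsLocalRing.residue R e) * hl - l₀ ^ 2 * he'
  obtain ⟨l, hl, -⟩ := HenselianLocalRing.exists_lift_root (f := X ^ 2 - C (-e))
    (monic_X_pow_sub_C _ two_ne_zero) (x := l₀)
    (by rw [eval₂_sub, eval₂_X_pow, eval₂_C, hsq, map_neg, sub_self])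
    (by
      rw [derivative_sub, derivative_X_pow, derivative_C, sub_zero]
      simpa using ⟨h2, h.isUnit_multiplier.ne_zero⟩)
  refine ⟨a, d, l, hpos, h2, hN, fun t h0 h1 => hunit ?_, him, ?_⟩
  · rw [map_torusIm]
    exact (h.isUnit_im t h0 h1).ne_zero
  · rw [eval_sub, eval_pow, eval_X, eval_C] at hl
    linear_combination (a ^ 2 - d) ^ (k - 1) * hl - he

end Lifting

/-! ### Torus data over the prime field. -/

section FiniteField

/-- With u, v = a ± √d, the √d-coefficient of the t-th power is (u^t - v^t)/(u - v), so what matters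
is that u/v has order 2k. -/
theorem isTorusDatum_of_eigenvalues {F K : Type*} [Field F] [Field K] (f : F →+* K)
    {a d l : F} {u v : K} {k : ℕ} (hk : 0 < k) (h2 : (2 : F) ≠ 0)
    (ha : 2 * f a = u + v) (hd : 4 * f d = (u - v) ^ 2) (hu : u ≠ 0) (hv : v ≠ 0)
    (hne : ∀ t, 0 < t → t < 2 * k → u ^ t ≠ v ^ t) (heq : u ^ (2 * k) = v ^ (2 * k))
    (hl : l ^ 2 * (a ^ 2 - d) ^ (k - 1) = -1) : IsTorusDatum a d l k := by
  have h2K : (2 : K) ≠ 0 := by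
    rw [← map_ofNat f 2]
    exact (map_ne_zero f).2 h2
  set r := (u - v) / 2 with hr
  have hr2 : r ^ 2 = f d := by
    rw [hr, div_pow, ← hd]
    field_simp
    ring
  have hu' : f a + r = u := by
    rw [hr]
    field_simp
    linear_combination ha
  have hv' : f a - r = v := by
    rw [hr]
    field_simp
    linear_combination ha
  have him : ∀ t, 2 * r * f (torusIm a d t) = u ^ t - v ^ t := by
    intro t
    rw [map_torusIm, ← hu', ← hv', ← torusRe_add_mul_torusIm _ hr2,
      ← torusRe_sub_mul_torusIm _ hr2]
    ring
  have hr0 : r ≠ 0 := by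
    have := hne 1 one_pos (by omega)
    rw [pow_one, pow_one] at this
    exact div_ne_zero (sub_ne_zero.2 this) h2K
  refine ⟨hk, h2.isUnit, Ne.isUnit ?_, fun t h0 h1 => Ne.isUnit fun h => ?_, ?_, hl⟩
  · refine fun h => mul_ne_zero hu hv ?_
    have := congrArg f h
    rw [map_sub, map_pow, map_zero, ← hr2] at this
    rw [← hu', ← hv', ← this]
    ring
  · have := him t
    rw [h, map_zero, mul_zero] at this
    exact hne t h0 h1 (sub_eq_zero.1 this.symm)
  · have := him (2 * k)
    rw [heq, sub_self] at this
    exact (map_eq_zero f).1 ((mul_eq_zero.1 this).resolve_left (mul_ne_zero h2K hr0))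

theorem exists_orderOf_eq_of_dvd_card {G : Type*} [Group G] [Finite G] [IsCyclic G] {m : ℕ}
    (hm : m ∣ Nat.card G) : ∃ x : G, orderOf x = m := by
  obtain ⟨g, hg⟩ := IsCyclic.exists_ofOrder_eq_natCard (α := G)
  exact ⟨g ^ (orderOf g / m), orderOf_pow_orderOf_div (by rw [hg]; exact Nat.card_pos.ne')
    (hg ▸ hm)⟩

theorem two_ne_zero_of_odd {p : ℕ} [Fact p.Prime] (hp : Odd p) : (2 : ZMod p) ≠ 0 := by
  have h := (ZMod.natCast_eq_zero_iff 2 p).not.2 fun h => by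
    have := (Nat.prime_dvd_prime_iff_eq (Fact.out : p.Prime) Nat.prime_two).1 h
    rw [this] at hp
    exact absurd hp (by decide)
  simpa using h

theorem exists_isTorusDatum_split {p k : ℕ} [Fact p.Prime] (hp : Odd p) (hk : 0 < k)
    (hdvd : 4 * k ∣ p - 1) : ∃ a d l : ZMod p, IsTorusDatum a d l k := by
  have h2 := two_ne_zero_of_odd hp
  have hcard : Nat.card (ZMod p)ˣ = p - 1 := by
    rw [Nat.card_eq_fintype_card, ZMod.card_units]
  obtain ⟨x, hx⟩ := exists_orderOf_eq_of_dvd_card (G := (ZMod p)ˣ) (hcard.symm ▸ hdvd)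
  set δ : ZMod p := x.val with hδ
  have hord : orderOf δ = 4 * k := by rw [hδ, orderOf_units, hx]
  have hδ0 : δ ≠ 0 := x.ne_zero
  have h1 : δ ^ (4 * k) = 1 := by rw [← hord, pow_orderOf_eq_one]
  have hlt : ∀ t, 0 < t → t < 4 * k → δ ^ t ≠ 1 := fun t h0 h1 h =>
    (Nat.le_of_dvd h0 (hord ▸ orderOf_dvd_of_pow_eq_one h)).not_gt h1
  have hneg : δ ^ (2 * k) = -1 := by
    have h3 : (δ ^ (2 * k)) ^ 2 = 1 := by rw [← pow_mul, ← h1]; congr 1; ring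
    exact (sq_eq_sq_iff_eq_or_eq_neg.1 (h3.trans (one_pow 2).symm)).resolve_left
      (hlt (2 * k) (by omega) (by omega))
  -- Eigenvalues δ^2 and 1 have ratio of order 2k and N = δ^2; with l = δ the multiplier condition
  -- reads δ^(2k) = -1.
  refine ⟨(δ ^ 2 + 1) / 2, ((δ ^ 2 - 1) / 2) ^ 2, δ,
    isTorusDatum_of_eigenvalues (RingHom.id _) (u := δ ^ 2) (v := 1) hk h2 ?_ ?_
      (pow_ne_zero 2 hδ0) one_ne_zero ?_ ?_ ?_⟩
  · simp only [RingHom.id_apply]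
    field_simp
  · simp only [RingHom.id_apply]
    field_simp
    ring
  · intro t h0 ht
    rw [one_pow, ← pow_mul]
    exact hlt _ (by omega) (by omega)
  · rw [one_pow, ← pow_mul, ← h1]
    congr 1
    ring
  · have h3 : ((δ ^ 2 + 1) / 2) ^ 2 - ((δ ^ 2 - 1) / 2) ^ 2 = δ ^ 2 := by
      field_simp
      ring
    rw [h3, ← hneg, ← pow_mul, ← pow_add]
    congr 1
    omega

theorem exists_zmod_of_pow_eq_self {p : ℕ} [Fact p.Prime] {K : Type*} [Field K] [CharP K p]
    (f : ZMod p →+* K) {x : K} (hx : x ^ p = x) : ∃ y : ZMod p, f y = x := by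
  have h := Subfield.mem_bot_iff_pow_eq_self (F := K) (p := p) (x := x) |>.2 hx
  rw [← ZMod.fieldRange_castHom_eq_bot (K := K) p] at h
  obtain ⟨y, hy⟩ := h
  exact ⟨y, by rw [← hy]; congr 1; exact Subsingleton.elim _ _⟩

/-- Conjugate eigenvalues h and h^p have their half-sum and squared half-difference fixed by
Frobenius, so a and d lie in the prime field. -/
theorem exists_isTorusDatum_of_card_sq {p k : ℕ} [Fact p.Prime] {K : Type*} [Field K] [Finite K]
    [CharP K p] (f : ZMod p →+* K) (hcard : Nat.card K = p ^ 2) (hp : p % 4 = 1) (hk : Odd k)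
    (hdvd : 2 * k ∣ p + 1) : ∃ a d l : ZMod p, IsTorusDatum a d l k := by
  have hp1 : 1 < p := (Fact.out : p.Prime).one_lt
  have h2 := two_ne_zero_of_odd (p := p) (Nat.odd_iff.2 (by omega))
  have h2K : (2 : K) ≠ 0 := by
    rw [← map_ofNat f 2]
    exact (map_ne_zero f).2 h2
  have := Fintype.ofFinite K
  have hcardU : Nat.card Kˣ = (p + 1) * (p - 1) := by
    rw [Nat.card_units, hcard, ← Nat.sq_sub_sq, one_pow]
  -- This order is chosen so that h^(p-1), the ratio of the eigenvalues, has order 2k.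
  obtain ⟨x, hx⟩ := exists_orderOf_eq_of_dvd_card (G := Kˣ) (m := 2 * k * (p - 1))
    (hcardU ▸ Nat.mul_dvd_mul_right hdvd _)
  set h : K := x.val with hh
  have hord : orderOf h = 2 * k * (p - 1) := by rw [hh, orderOf_units, hx]
  have h0 : h ≠ 0 := x.ne_zero
  have hfrob : ∀ t, h ^ t = (h ^ p) ^ t ↔ 2 * k ∣ t := by
    intro t
    have h1 : (h ^ p) ^ t = h ^ t * h ^ ((p - 1) * t) := by
      rw [← pow_mul, ← pow_add]
      congr 1
      obtain ⟨q, rfl⟩ : ∃ q, p = q + 1 := ⟨p - 1, by omega⟩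
      rw [Nat.add_sub_cancel]
      ring
    rw [h1, eq_comm, mul_eq_left₀ (pow_ne_zero t h0), ← orderOf_dvd_iff_pow_eq_one, hord,
      mul_comm (p - 1)]
    exact Nat.mul_dvd_mul_iff_right (by omega)
  have hpp : (h ^ p) ^ p = h := by
    rw [← pow_mul, ← sq, ← hcard, Nat.card_eq_fintype_card, FiniteField.pow_card]
  have hadd : (h + h ^ p) ^ p = h + h ^ p := by
    rw [add_pow_char, hpp, add_comm]
  have h2p : (2 : K) ^ p = 2 := by
    have := congrArg f (ZMod.pow_card (2 : ZMod p))
    simpa only [map_pow, map_ofNat] using this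
  have hodd : Odd p := Nat.odd_iff.2 (by omega)
  obtain ⟨a, ha⟩ := exists_zmod_of_pow_eq_self f (x := (h + h ^ p) / 2)
    (by rw [div_pow, hadd, h2p])
  obtain ⟨d, hd⟩ := exists_zmod_of_pow_eq_self f (x := ((h - h ^ p) / 2) ^ 2)
    (by rw [← pow_mul, mul_comm, pow_mul, div_pow, sub_pow_char, hpp, h2p,
      ← neg_sub, neg_div, neg_sq])
  obtain ⟨w, hw⟩ := (ZMod.exists_sq_eq_neg_one_iff (p := p)).2 (by omega)
  obtain ⟨m, hm⟩ := hk
  have hN : a ^ 2 - d ≠ 0 := by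
    intro hN
    have h3 := congrArg f hN
    rw [map_sub, map_pow, ha, hd, map_zero] at h3
    refine mul_ne_zero h0 (pow_ne_zero p h0) ?_
    rw [← h3]
    field_simp
    ring
  -- With k - 1 = 2m and w^2 = -1, this l is a square root of -N^(-(k-1)).
  refine ⟨a, d, w * ((a ^ 2 - d)⁻¹) ^ m, isTorusDatum_of_eigenvalues f (u := h) (v := h ^ p)
    (by omega) h2 ?_ ?_ h0 (pow_ne_zero p h0) ?_ ((hfrob _).2 dvd_rfl) ?_⟩
  · rw [ha]
    field_simp
  · rw [hd]
    field_simp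
    ring
  · intro t ht0 ht h3
    exact (Nat.le_of_dvd ht0 ((hfrob t).1 h3)).not_gt ht
  · rw [hm, Nat.add_sub_cancel, mul_pow, sq w, ← hw, inv_pow, inv_pow, ← pow_mul, mul_comm m 2,
      mul_assoc, inv_mul_cancel₀ (pow_ne_zero _ hN), mul_one]

theorem exists_isTorusDatum_nonsplit {p k : ℕ} [Fact p.Prime] (hp : p % 4 = 1) (hk : Odd k)
    (hdvd : 2 * k ∣ p + 1) : ∃ a d l : ZMod p, IsTorusDatum a d l k :=
  have hcard : Nat.card (GaloisField p 2) = p ^ 2 := GaloisField.card p 2 two_ne_zero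
  have : Finite (GaloisField p 2) :=
    Nat.finite_of_card_ne_zero (hcard ▸ pow_ne_zero 2 (Fact.out : p.Prime).ne_zero)
  exists_isTorusDatum_of_card_sq (algebraMap (ZMod p) (GaloisField p 2)) hcard hp hk hdvd

end FiniteField

theorem exists_negacyclic_mds_selfDual {n p : ℕ} (hn : Even n) (hp : p.Prime) (hodd : Odd p)
    (hcop : n.Coprime p) (hpar : ParamsOne n p ∨ ParamsTwo n p) {R : Type*} [CommRing R]
    [IsLocalRing R] (hR : IsChainRing R) (hcard : Nat.card (IsLocalRing.ResidueField R) = p) :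
    ∃ C : Submodule R (Fin n → R), IsNegacyclic C ∧ IsMDS C ∧ IsSelfDual C := by
  have : Fact p.Prime := ⟨hp⟩
  have hH := hR.henselianLocalRing
  obtain ⟨k, rfl⟩ := even_iff_two_dvd.1 hn
  have hk : 0 < k := by
    rcases Nat.eq_zero_or_pos k with rfl | hk
    · simp only [mul_zero, Nat.coprime_zero_left] at hcop
      exact absurd hcop hp.one_lt.ne'
    · exact hk
  have hdatum : ∃ a d l : ZMod p, IsTorusDatum a d l k := by
    rcases hpar with ⟨n', hn', hkn, hp4, hdvd⟩ | ⟨a, n', -, hkn, hmod, -⟩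
    · obtain rfl : k = n' := by omega
      exact exists_isTorusDatum_nonsplit hp4 hn' hdvd
    · refine exists_isTorusDatum_split hodd hk ?_
      have h4 : 4 * k = 2 ^ (a + 1) * n' := by rw [pow_succ, mul_right_comm, ← hkn]; ring
      rw [h4]
      exact (Nat.modEq_iff_dvd' hp.one_lt.le).1 hmod.symm
  obtain ⟨a, d, l, h⟩ := hdatum
  have : Finite (IsLocalRing.ResidueField R) :=
    Nat.finite_of_card_ne_zero (by rw [hcard]; exact hp.ne_zero)
  have := Fintype.ofFinite (IsLocalRing.ResidueField R)
  let φ := ZMod.ringEquivOfPrime (IsLocalRing.ResidueField R) hp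
    (by rw [← Nat.card_eq_fintype_card, hcard])
  have hne : ((2 * k : ℕ) : IsLocalRing.ResidueField R) ≠ 0 := by
    rw [← map_natCast φ, map_ne_zero_iff φ φ.injective, Ne, ZMod.natCast_eq_zero_iff]
    exact (hp.coprime_iff_not_dvd).1 hcop.symm
  obtain ⟨a', d', l', h'⟩ := (h.map φ.toRingHom).exists_lift hne
  exact h'.exists_code

/-! ### Infinitely many admissible primes, by Dirichlet's theorem. -/

section Primes

theorem infinite_paramsOne {n' : ℕ} (hn' : Odd n') :
    {p : ℕ | p.Prime ∧ Odd p ∧ (2 * n').Coprime p ∧ ParamsOne (2 * n') p}.Infinite := by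
  obtain ⟨m, rfl⟩ := hn'
  refine Set.infinite_of_forall_exists_gt fun N => ?_
  -- For n' = 2m + 1 the class of 2n' - 1 modulo 4n' is -1 modulo 2n' and 1 modulo 4.
  obtain ⟨p, hpN, hp, hmod⟩ := Nat.forall_exists_prime_gt_and_zmodEq N
    (q := 4 * (2 * m + 1)) (a := 2 * (2 * m + 1) - 1) (by omega)
    ⟨2 * (2 * m + 1) - 1, -(2 * m), by push_cast; ring⟩
  obtain ⟨c, hc⟩ := hmod.dvd
  have hdvd : 2 * (2 * m + 1) ∣ p + 1 := by
    zify
    refine ⟨1 - 2 * c, ?_⟩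
    push_cast at hc
    linear_combination -hc
  have hp4 : p % 4 = 1 := by
    push_cast at hc
    have h3 : (p : ℤ) = 1 + 4 * (m - (2 * m + 1) * c) := by linear_combination -hc
    omega
  have hcop : (2 * (2 * m + 1)).Coprime p :=
    Nat.Coprime.coprime_dvd_left hdvd (by simp)
  exact ⟨p, ⟨hp, Nat.odd_iff.2 (by omega), hcop, 2 * m + 1, ⟨m, rfl⟩, rfl, hp4, hdvd⟩, hpN⟩

theorem infinite_paramsTwo {n : ℕ} (hn : 0 < n) :
    {p : ℕ | p.Prime ∧ Odd p ∧ n.Coprime p ∧ ParamsTwo n p}.Infinite := by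
  refine Set.infinite_of_forall_exists_gt fun N => ?_
  -- The modulus 2n is 2^(a+1) n'.
  obtain ⟨p, hpN, hp, hmod⟩ := Nat.forall_exists_prime_gt_and_zmodEq N
    (q := 2 * n) (a := 1) (by omega) isCoprime_one_left
  have hmod' : p ≡ 1 [MOD 2 * n] := by
    rw [← Int.natCast_modEq_iff]
    simpa using hmod
  have hdvd : 2 * n ∣ p - 1 := (Nat.modEq_iff_dvd' hp.one_lt.le).1 hmod'.symm
  have hodd : Odd p := by
    obtain ⟨c, hc⟩ := (Dvd.intro n rfl : 2 ∣ 2 * n).trans hdvd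
    have := hp.one_lt
    exact ⟨c, by omega⟩
  have hcop : n.Coprime p := by
    refine Nat.Coprime.coprime_dvd_left ((Dvd.intro_left 2 rfl).trans hdvd) ?_
    have h1 : p = p - 1 + 1 := by have := hp.one_lt; omega
    rw [h1, Nat.add_sub_cancel]
    simp
  obtain ⟨a, n', hn', hna⟩ := Nat.exists_eq_two_pow_mul_odd hn.ne'
  refine ⟨p, ⟨hp, hodd, hcop, a, n', hn', hna, ?_, (Dvd.intro_left 2 rfl).trans hdvd⟩, hpN⟩
  rwa [pow_succ, mul_right_comm, ← hna, mul_comm]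

end Primes

theorem mainTheorem6 :
    (∀ n p : ℕ, Even n → p.Prime → Odd p → n.Coprime p → (ParamsOne n p ∨ ParamsTwo n p) →
      ∀ (R : Type*) [CommRing R] [IsLocalRing R], IsChainRing R →
        Nat.card (IsLocalRing.ResidueField R) = p →
        ∃ C : Submodule R (Fin n → R), IsNegacyclic C ∧ IsMDS C ∧ IsSelfDual C) ∧
    (∀ n' : ℕ, Odd n' →
      {p : ℕ | p.Prime ∧ Odd p ∧ (2 * n').Coprime p ∧ ParamsOne (2 * n') p}.Infinite) ∧
    (∀ n : ℕ, 0 < n → Even n →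
      {p : ℕ | p.Prime ∧ Odd p ∧ n.Coprime p ∧ ParamsTwo n p}.Infinite) :=
  ⟨fun _ _ hn hp hodd hcop hpar _ _ _ hR hcard =>
    exists_negacyclic_mds_selfDual hn hp hodd hcop hpar hR hcard,
    fun _ hn' => infinite_paramsOne hn', fun _ hn _ => infinite_paramsTwo hn⟩
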